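/- Let $n\ge 1$ and $d\ge 4$ be integers and let $\Sigma$ be an arbitrary $d\times d$ (symmetric) positive definite matrix. Let $\mu=(\mu_1,\dots,\mu_d)^{T}\sim G_0=N_d(0,\Sigma)$ and, given $\mu$, let $Y_{ij}\sim N(\mu_j,1)$ be independent for $i=1,\dots,n$ and $j=1,\dots,d$. Write $\bar Y_j=n^{-1}\sum_{i=1}^n Y_{ij}$ and $\bar Y=d^{-1}\sum_{j=1}^d\bar Y_j$, and consider the estimators $\hat\mu_{HB}$ and $\hat\mu_{PHB}$ of $\mu$ with components $$\hat\mu_{j,HB}=\bar Y+\Big[1-\frac{d-3}{n\sum_{k=1}^d(\bar Y_k-\bar Y)^2}\Big](\bar Y_j-\bar Y),\qquad \hat\mu_{j,PHB}=\Big[1-\frac{d-2}{n\sum_{k=1}^d\bar Y_k^2}\Big]\bar Y_j .$$ For an estimator $\hat\mu$ let $R(\hat\mu,G_0)=\int_{\mathbb R^d}E_{Y\mid\mu}\|\hat\mu-\mu\|_2^2\,dG_0(\mu)$ be its integrated squared $\ell_2$ risk. Let $P$ be a $d\times d$ orthogonal matrix and $\Lambda$ a diagonal matrix with diagonal entries $\lambda_1,\dots,\lambda_d$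 such that $P\Lambda P^{T}=\Sigma$ (so $\lambda_1,\dots,\lambda_d>0$ are the eigenvalues of $\Sigma$), let $1_d$ be the vector in $\mathbb R^d$ with all components equal to $1$, let $Z=P^{T}1_d$, and for $u\in[0,1]$ put $$\xi_1(u)=\Big[1-\frac{n(1-u)}{d}\sum_{j=1}^d\frac{\lambda_jZ_j^2}{1+n(1-u)\lambda_j}\Big]\prod_{j=1}^d\{1+n(1-u)\lambda_j\},\qquad \xi_2(u)=\prod_{j=1}^d\{1+n(1-u)\lambda_j\}.$$ Then $\xi_1$ and $\xi_2$ are positive on $[0,1]$, both integrated risks and the integrals below are finite, and $$R(\hat\mu_{HB},G_0)=\frac dn-\frac{(d-3)^2}{2n}\int_0^1\frac{u^{(d-3)/2-1}}{\sqrt{\xi_1(u)}}\,du,\qquad R(\hat\mu_{PHB},G_0)=\frac dn-\frac{(d-2)^2}{2n}\int_0^1\frac{u^{(d-2)/2-1}}{\sqrt{\xi_2(u)}}\,du .$$ -/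

import Mathlib

open MeasureTheory ProbabilityTheory
open scoped Matrix

noncomputable section

namespace NormalMeans

/-- A data set `Y`: `Y i j` is the `i`-th observation (`i = 1, …, n`) from the `j`-th normal
population (`j = 1, …, d`). -/
abbrev Data (n d : ℕ) : Type := Fin n → Fin d → ℝ

/-- The conditional law of `Y` given `μ`: the `Y i j` are independent, `Y i j ∼ N(μ j, 1)`. -/
def dataLaw (n : ℕ) {d : ℕ} (μ : EuclideanSpace ℝ (Fin d)) : Measure (Data n d) :=
  Measure.pi fun _ : Fin n => Measure.pi fun j : Fin d => gaussianReal (μ j) 1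

/-- The sample mean of the `j`-th population. -/
def popMean {n d : ℕ} (Y : Data n d) (j : Fin d) : ℝ := (∑ i, Y i j) / n

/-- The grand mean. -/
def grandMean {n d : ℕ} (Y : Data n d) : ℝ := (∑ j, popMean Y j) / d

/-- The empirical Bayes estimator of `μ` under the partial-hierarchical Bayes model. -/
def estPHB {n d : ℕ} (Y : Data n d) : EuclideanSpace ℝ (Fin d) :=
  WithLp.toLp 2 fun j =>
    (1 - ((d : ℝ) - 2) / (n * ∑ k, popMean Y k ^ 2)) * popMean Y j

/-- The empirical Bayes estimator of `μ` under the hierarchical Bayes model. -/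
def estHB {n d : ℕ} (Y : Data n d) : EuclideanSpace ℝ (Fin d) :=
  WithLp.toLp 2 fun j =>
    grandMean Y + (1 - ((d : ℝ) - 3) / (n * ∑ k, (popMean Y k - grandMean Y) ^ 2)) *
      (popMean Y j - grandMean Y)

/-- The squared `ℓ²` loss of an estimator. -/
def loss {n d : ℕ} (est : Data n d → EuclideanSpace ℝ (Fin d)) (μ : EuclideanSpace ℝ (Fin d))
    (Y : Data n d) : ℝ :=
  ‖est Y - μ‖ ^ 2

/-- The risk of an estimator at a fixed parameter `μ`. -/
def risk {n d : ℕ} (est : Data n d → EuclideanSpace ℝ (Fin d))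
    (μ : EuclideanSpace ℝ (Fin d)) : ℝ :=
  ∫ Y, loss est μ Y ∂(dataLaw n μ)

/-- The integrated risk of an estimator with respect to a law `G` of the parameter. -/
def integratedRisk {n d : ℕ} (est : Data n d → EuclideanSpace ℝ (Fin d))
    (G : Measure (EuclideanSpace ℝ (Fin d))) : ℝ :=
  ∫ μ, risk est μ ∂G

/-- The expectations that define the integrated risk exist and are finite. -/
def FiniteIntegratedRisk {n d : ℕ} (est : Data n d → EuclideanSpace ℝ (Fin d))
    (G : Measure (EuclideanSpace ℝ (Fin d))) : Prop :=
  (∀ μ, Integrable (loss est μ) (dataLaw n μ)) ∧ Integrable (risk est) G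

/-- `ξ₂(u) = ∏ⱼ (1 + n (1 - u) λⱼ)`. -/
def xi₂ (n : ℕ) {d : ℕ} (lam : Fin d → ℝ) (u : ℝ) : ℝ :=
  ∏ j, (1 + n * (1 - u) * lam j)

/-- `ξ₁(u) = [1 - (n (1 - u) / d) ∑ⱼ λⱼ Zⱼ² / (1 + n (1 - u) λⱼ)] ∏ⱼ (1 + n (1 - u) λⱼ)`. -/
def xi₁ (n : ℕ) {d : ℕ} (lam Z : Fin d → ℝ) (u : ℝ) : ℝ :=
  (1 - n * (1 - u) / d * ∑ j, lam j * Z j ^ 2 / (1 + n * (1 - u) * lam j)) *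
    ∏ j, (1 + n * (1 - u) * lam j)

end NormalMeans

end

/-!
The vector `x` of sample means has law `N(μ, n⁻¹ • 1)`, and both estimators are James–Stein
estimators that shrink `x` along the column space of a matrix `W` with orthonormal columns: `W = 1`
for the partial-hierarchical one, and `W * Wᵀ = 1 - d⁻¹ • J`, with `J` the all-ones matrix, for the
hierarchical one. If `W` has `k` columns, Stein's identity gives the risk
`d / n - ((k - 2) / n)² E‖Wᵀx‖⁻²`, and averaging over the prior replaces the law of `x` by
`N(0, S + n⁻¹ • 1)`. As `q⁻¹ = ∫₀^∞ exp (-t q) dt`, the inverse moment is the integral over `t` of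
`det (1 + 2t (WᵀSW + n⁻¹ • 1))^(-1/2)`. The substitution `2t = n (u⁻¹ - 1)` turns this determinant
into `u⁻ᵏ det (1 + n (1 - u) • WᵀSW)`, which is evaluated in the eigenbasis of `S`; in the
hierarchical case it is that of a rank one perturbation of a diagonal matrix.
-/

open scoped NNReal RealInnerProductSpace

namespace NormalMeans

section Real

variable {m : ℝ} {v : ℝ≥0}

lemma gaussianPDFReal_mul_exp_mul_sq (hv : v ≠ 0) {t : ℝ} (ht : 2 * t * v < 1) (x : ℝ) :
    gaussianPDFReal m v x * Real.exp (t * x ^ 2) =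
      (√(1 - 2 * t * v))⁻¹ * Real.exp (t * m ^ 2 / (1 - 2 * t * v)) *
        gaussianPDFReal (m / (1 - 2 * t * v)) (v / (1 - 2 * t * v).toNNReal) x := by
  obtain ⟨p, hp, hp_def⟩ : ∃ p : ℝ, 0 < p ∧ p = 1 - 2 * t * v := ⟨_, by linarith, rfl⟩
  have : (0 : ℝ) < v := by positivity
  have h_exponent : -(x - m) ^ 2 / (2 * v) + t * x ^ 2 =
      t * m ^ 2 / p + -(x - m / p) ^ 2 / (2 * (v / p)) := by
    field_simp
    rw [hp_def]
    ring
  have h_const : (√(2 * Real.pi * (v / p)))⁻¹ = √p * (√(2 * Real.pi * v))⁻¹ := by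
    rw [← mul_div_assoc, Real.sqrt_div (by positivity), inv_div, div_eq_mul_inv]
  rw [← hp_def, gaussianPDFReal, gaussianPDFReal, NNReal.coe_div, Real.coe_toNNReal _ hp.le,
    h_const, mul_assoc, ← Real.exp_add, h_exponent, Real.exp_add]
  have := (Real.sqrt_pos.2 hp).ne'
  field_simp

lemma mgf_sq_gaussianReal (m : ℝ) (v : ℝ≥0) {t : ℝ} (ht : 2 * t * v < 1) :
    mgf (fun x => x ^ 2) (gaussianReal m v) t =
      (√(1 - 2 * t * v))⁻¹ * Real.exp (t * m ^ 2 / (1 - 2 * t * v)) := by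
  rcases eq_or_ne v 0 with rfl | hv
  · simp [mgf]
  have hp : 0 < (1 - 2 * t * v).toNNReal := Real.toNNReal_pos.2 (by linarith)
  simp only [mgf, integral_gaussianReal_eq_integral_smul hv, smul_eq_mul,
    gaussianPDFReal_mul_exp_mul_sq hv ht]
  rw [integral_const_mul, integral_gaussianPDFReal_eq_one _ (div_ne_zero hv hp.ne'), mul_one]

lemma hasDerivAt_gaussianPDFReal (m : ℝ) (v : ℝ≥0) (x : ℝ) :
    HasDerivAt (gaussianPDFReal m v) (-((x - m) / v) * gaussianPDFReal m v x) x := by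
  have h_exponent : HasDerivAt (fun y : ℝ => -(y - m) ^ 2 / (2 * (v : ℝ))) (-((x - m) / v)) x := by
    refine ((((hasDerivAt_id' x).sub_const m).pow 2).neg.div_const (2 * (v : ℝ))).congr_deriv ?_
    push_cast
    ring
  rw [gaussianPDFReal_def]
  exact (h_exponent.exp.const_mul _).congr_deriv (by ring)

lemma integrable_gaussianReal_iff (hv : v ≠ 0) {f : ℝ → ℝ} :
    Integrable f (gaussianReal m v) ↔ Integrable (fun x => f x * gaussianPDFReal m v x) := by
  rw [gaussianReal_of_var_ne_zero _ hv,
    integrable_withDensity_iff (measurable_gaussianPDF m v) (by simp [gaussianPDF_lt_top])]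
  simp only [toReal_gaussianPDF]

/-- Stein's identity, by integration by parts against the Gaussian density. -/
lemma integral_sub_mul_gaussianReal (hv : v ≠ 0) {f f' : ℝ → ℝ}
    (hf : ∀ x, HasDerivAt f (f' x) x) (hf_int : Integrable f (gaussianReal m v))
    (hmul_int : Integrable (fun x => (x - m) * f x) (gaussianReal m v))
    (hf'_int : Integrable f' (gaussianReal m v)) :
    ∫ x, (x - m) * f x ∂gaussianReal m v = v * ∫ x, f' x ∂gaussianReal m v := by
  have hv₀ : (v : ℝ) ≠ 0 := by exact_mod_cast hv
  have h_parts := integral_mul_deriv_eq_deriv_mul_of_integrable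
    (fun x _ => hf x) (fun x _ => hasDerivAt_gaussianPDFReal m v x)
    (((integrable_gaussianReal_iff hv).1 (hmul_int.const_mul (-(v : ℝ)⁻¹))).congr
      (ae_of_all _ fun x => by simp only [Pi.mul_apply]; field_simp))
    ((integrable_gaussianReal_iff hv).1 hf'_int) ((integrable_gaussianReal_iff hv).1 hf_int)
  simp only [integral_gaussianReal_eq_integral_smul hv, smul_eq_mul]
  calc ∫ x, gaussianPDFReal m v x * ((x - m) * f x)
      = -v * ∫ x, f x * (-((x - m) / v) * gaussianPDFReal m v x) := by
        rw [← integral_const_mul]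
        congr with x
        field_simp
    _ = v * ∫ x, f' x * gaussianPDFReal m v x := by rw [h_parts]; ring
    _ = v * ∫ x, gaussianPDFReal m v x * f' x := by simp only [mul_comm]

end Real

section Pi

variable {κ : Type*} [Fintype κ]

lemma measurePreserving_update [DecidableEq κ] {α : κ → Type*} [∀ k, MeasurableSpace (α k)]
    (μ : ∀ k, Measure (α k)) [∀ k, IsProbabilityMeasure (μ k)] (k : κ) :
    MeasurePreserving (fun p : (∀ i, α i) × α k => Function.update p.1 k p.2)
      ((Measure.pi μ).prod (μ k)) (Measure.pi μ) := by
  have h_meas : Measurable fun p : (∀ i, α i) × α k => Function.update p.1 k p.2 :=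
    measurable_update'
  refine ⟨h_meas, (Measure.pi_eq fun s hs => ?_).symm⟩
  have h_preimage : (fun p : (∀ i, α i) × α k => Function.update p.1 k p.2) ⁻¹' Set.univ.pi s =
      Set.univ.pi (Function.update s k Set.univ) ×ˢ s k := by
    ext ⟨y, x⟩
    simp only [Set.mem_preimage, Set.mem_pi, Set.mem_univ, true_imp_iff, Set.mem_prod]
    rw [Function.forall_update_iff y (fun i z => z ∈ s i),
      Function.forall_update_iff s (fun i S => y i ∈ S), and_comm]
    simp
  rw [Measure.map_apply h_meas (.univ_pi hs), h_preimage, Measure.prod_prod, Measure.pi_pi,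
    mul_comm, ← Finset.mul_prod_erase _ _ (Finset.mem_univ k),
    ← Finset.mul_prod_erase _ (fun i => μ i (s i)) (Finset.mem_univ k)]
  simp only [Function.update_self, measure_univ, one_mul]
  congr 1
  refine Finset.prod_congr rfl fun i hi => ?_
  rw [Function.update_of_ne (Finset.ne_of_mem_erase hi)]

lemma integral_sub_mul_pi_gaussianReal [DecidableEq κ] (m : κ → ℝ) {v : ℝ≥0} (hv : v ≠ 0) (k : κ)
    {f f' : (κ → ℝ) → ℝ}
    (hf : ∀ᵐ y ∂Measure.pi fun i => gaussianReal (m i) v,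
      ∀ x, HasDerivAt (fun x => f (Function.update y k x)) (f' (Function.update y k x)) x)
    (hf_int : Integrable f (Measure.pi fun i => gaussianReal (m i) v))
    (hmul_int : Integrable (fun y => (y k - m k) * f y)
      (Measure.pi fun i => gaussianReal (m i) v))
    (hf'_int : Integrable f' (Measure.pi fun i => gaussianReal (m i) v)) :
    ∫ y, (y k - m k) * f y ∂Measure.pi (fun i => gaussianReal (m i) v) =
      v * ∫ y, f' y ∂Measure.pi fun i => gaussianReal (m i) v := by
  have h_update := measurePreserving_update (fun i => gaussianReal (m i) v) k
  have h_slice {g : (κ → ℝ) → ℝ} (hg : Integrable g (Measure.pi fun i => gaussianReal (m i) v)) :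
      Integrable (fun p : (κ → ℝ) × ℝ => g (Function.update p.1 k p.2))
        ((Measure.pi fun i => gaussianReal (m i) v).prod (gaussianReal (m k) v)) :=
    h_update.integrable_comp_of_integrable hg
  have h_fubini {g : (κ → ℝ) → ℝ} (hg : Integrable g (Measure.pi fun i => gaussianReal (m i) v)) :
      ∫ y, g y ∂Measure.pi (fun i => gaussianReal (m i) v) =
        ∫ y, ∫ x, g (Function.update y k x) ∂gaussianReal (m k) v
          ∂Measure.pi fun i => gaussianReal (m i) v := by
    rw [← integral_prod _ (h_slice hg), ← h_update.map_eq,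
      integral_map h_update.aemeasurable (by rw [h_update.map_eq]; exact hg.aestronglyMeasurable),
      h_update.map_eq]
  rw [h_fubini hmul_int, h_fubini hf'_int, ← integral_const_mul]
  refine integral_congr_ae ?_
  filter_upwards [hf, (h_slice hf_int).prod_right_ae, (h_slice hmul_int).prod_right_ae,
    (h_slice hf'_int).prod_right_ae] with y hy hy_f hy_mul hy_f'
  simp only [Function.update_self] at hy_mul ⊢
  exact integral_sub_mul_gaussianReal hv hy hy_f hy_mul hy_f'

end Pi

section InverseMoment

variable {Ω : Type*} [MeasurableSpace Ω] {ν : Measure Ω} [IsFiniteMeasure ν] {q : Ω → ℝ}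

-- At `c = 0` both sides are `0`: the integral diverges and `0⁻¹ = 0`.
lemma integral_exp_neg_mul_Ioi {c : ℝ} (hc : 0 ≤ c) :
    ∫ t in Set.Ioi (0 : ℝ), Real.exp (-t * c) = c⁻¹ := by
  rcases hc.eq_or_lt with rfl | hc
  · simp [Measure.real]
  simpa only [neg_mul, mul_comm c, mul_zero, neg_zero, Real.exp_zero, neg_div_neg_eq, one_div]
    using integral_exp_mul_Ioi (neg_lt_zero.2 hc) 0

lemma integrable_exp_neg_mul_prod (hq : AEMeasurable q ν) (hq_nonneg : 0 ≤ q)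
    (h_mgf : IntegrableOn (fun t => mgf q ν (-t)) (Set.Ioi 0)) :
    Integrable (fun p : Ω × ℝ => Real.exp (-p.2 * q p.1))
      (ν.prod (volume.restrict (Set.Ioi 0))) := by
  have h_meas : AEStronglyMeasurable (fun p : Ω × ℝ => Real.exp (-p.2 * q p.1))
      (ν.prod (volume.restrict (Set.Ioi 0))) :=
    (Real.measurable_exp.comp_aemeasurable
      (measurable_snd.neg.aemeasurable.mul hq.comp_fst)).aestronglyMeasurable
  refine (integrable_prod_iff' h_meas).2 ⟨?_, ?_⟩
  · filter_upwards [ae_restrict_mem measurableSet_Ioi] with t ht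
    refine Integrable.of_bound (by fun_prop) 1 (ae_of_all _ fun ω => ?_)
    rw [Real.norm_eq_abs, Real.abs_exp, Real.exp_le_one_iff]
    exact mul_nonpos_of_nonpos_of_nonneg (neg_nonpos.2 (le_of_lt ht)) (hq_nonneg ω)
  · simp only [Real.norm_eq_abs, Real.abs_exp]
    exact h_mgf

lemma integrable_inv_of_integrableOn_mgf (hq : AEMeasurable q ν) (hq_nonneg : 0 ≤ q)
    (h_mgf : IntegrableOn (fun t => mgf q ν (-t)) (Set.Ioi 0)) :
    Integrable (fun ω => (q ω)⁻¹) ν := by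
  simpa only [integral_exp_neg_mul_Ioi (hq_nonneg _)] using
    (integrable_exp_neg_mul_prod hq hq_nonneg h_mgf).integral_prod_left

lemma integral_inv_eq_integral_mgf (hq : AEMeasurable q ν) (hq_nonneg : 0 ≤ q)
    (h_mgf : IntegrableOn (fun t => mgf q ν (-t)) (Set.Ioi 0)) :
    ∫ ω, (q ω)⁻¹ ∂ν = ∫ t in Set.Ioi 0, mgf q ν (-t) := by
  simp only [← integral_exp_neg_mul_Ioi (hq_nonneg _)]
  exact integral_integral_swap (integrable_exp_neg_mul_prod hq hq_nonneg h_mgf)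

end InverseMoment

section NoncentralChiSq

variable {κ : Type*} [Fintype κ] (m : κ → ℝ) {v : ℝ≥0}

lemma mgf_sum_sq_pi_gaussianReal (v : κ → ℝ≥0) {t : ℝ} (ht : ∀ k, 2 * t * v k < 1) :
    mgf (fun y => ∑ k, y k ^ 2) (Measure.pi fun k => gaussianReal (m k) (v k)) t =
      ∏ k, (√(1 - 2 * t * v k))⁻¹ * Real.exp (t * m k ^ 2 / (1 - 2 * t * v k)) := by
  simp only [mgf, Finset.mul_sum, Real.exp_sum]
  rw [integral_fintype_prod_eq_prod fun _ x => Real.exp (t * x ^ 2)]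
  exact Finset.prod_congr rfl fun k _ => mgf_sq_gaussianReal (m k) (v k) (ht k)

lemma mgf_sum_sq_pi_gaussianReal_le {t : ℝ} (ht : 0 ≤ t) :
    mgf (fun y => ∑ k, y k ^ 2) (Measure.pi fun k => gaussianReal (m k) v) (-t) ≤
      (1 + 2 * v * t) ^ (-(Fintype.card κ : ℝ) / 2) := by
  have h_pos : 0 < 1 + 2 * v * t := by positivity
  have h_base : 1 - 2 * -t * (v : ℝ) = 1 + 2 * v * t := by ring
  rw [mgf_sum_sq_pi_gaussianReal m (fun _ => v) fun _ => by linarith]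
  calc ∏ k, (√(1 - 2 * -t * v))⁻¹ * Real.exp (-t * m k ^ 2 / (1 - 2 * -t * v))
      ≤ ∏ _k : κ, (1 + 2 * v * t) ^ (-(1 / 2) : ℝ) := by
        refine Finset.prod_le_prod (fun _ _ => by positivity) fun k _ => ?_
        rw [h_base, Real.sqrt_eq_rpow, ← Real.rpow_neg h_pos.le]
        refine mul_le_of_le_one_right (by positivity) (Real.exp_le_one_iff.2 ?_)
        rw [neg_mul, neg_div, neg_nonpos]
        positivity
    _ = (1 + 2 * v * t) ^ (-(Fintype.card κ : ℝ) / 2) := by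
        rw [Finset.prod_const, Finset.card_univ, ← Real.rpow_mul_natCast h_pos.le]
        congr 1
        ring

lemma integrable_inv_sum_sq_pi_gaussianReal (hv : v ≠ 0) (hκ : 2 < Fintype.card κ) :
    Integrable (fun y => (∑ k, y k ^ 2)⁻¹) (Measure.pi fun k => gaussianReal (m k) v) := by
  have hv₀ : (0 : ℝ) < v := by positivity
  have hκ' : (2 : ℝ) < Fintype.card κ := by exact_mod_cast hκ
  have h_rpow : IntegrableOn (fun t : ℝ => (1 + 2 * v * t) ^ (-(Fintype.card κ : ℝ) / 2))
      (Set.Ioi 0) := by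
    have h_shift : IntegrableOn (fun t : ℝ => (t + (2 * v : ℝ)⁻¹) ^ (-(Fintype.card κ : ℝ) / 2))
        (Set.Ioi 0) := integrableOn_add_rpow_Ioi_of_lt (by linarith) (by simpa using hv₀)
    refine IntegrableOn.congr_fun (h_shift.const_mul ((2 * v : ℝ) ^ (-(Fintype.card κ : ℝ) / 2)))
      (fun t (ht : 0 < t) => ?_) measurableSet_Ioi
    rw [← Real.mul_rpow (by positivity) (by positivity), mul_add,
      mul_inv_cancel₀ (by positivity), add_comm]
  have h_meas : AEStronglyMeasurable (fun t => mgf (fun y => ∑ k, y k ^ 2)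
      (Measure.pi fun k => gaussianReal (m k) v) (-t)) (volume.restrict (Set.Ioi 0)) :=
    (StronglyMeasurable.integral_prod_left (f := fun (y : κ → ℝ) t => Real.exp (-t * ∑ k, y k ^ 2))
      (Measurable.stronglyMeasurable (by fun_prop))).aestronglyMeasurable
  refine integrable_inv_of_integrableOn_mgf (Measurable.aemeasurable (by fun_prop))
    (fun y => Finset.sum_nonneg fun k _ => sq_nonneg _) (h_rpow.mono' h_meas ?_)
  filter_upwards [ae_restrict_mem measurableSet_Ioi] with t ht
  rw [Real.norm_of_nonneg mgf_nonneg]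
  exact mgf_sum_sq_pi_gaussianReal_le m (le_of_lt ht)

lemma memLp_sub_pi_gaussianReal (v : ℝ≥0) (k : κ) :
    MemLp (fun y => y k - m k) 2 (Measure.pi fun i => gaussianReal (m i) v) :=
  ((memLp_id_gaussianReal 2).sub (memLp_const (m k))).comp_measurePreserving
    (measurePreserving_eval (fun i => gaussianReal (m i) v) k)

lemma memLp_div_sum_sq_pi_gaussianReal (hv : v ≠ 0) (hκ : 2 < Fintype.card κ) (k : κ) :
    MemLp (fun y => y k / ∑ j, y j ^ 2) 2 (Measure.pi fun i => gaussianReal (m i) v) := by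
  have h_meas : Measurable fun y : κ → ℝ => y k / ∑ j, y j ^ 2 := by fun_prop
  refine (memLp_two_iff_integrable_sq h_meas.aestronglyMeasurable).2
    ((integrable_inv_sum_sq_pi_gaussianReal m hv hκ).mono'
      (h_meas.pow_const 2).aestronglyMeasurable (ae_of_all _ fun y => ?_))
  rw [Real.norm_of_nonneg (sq_nonneg _), div_pow, sq (∑ j, y j ^ 2), ← div_div, ← one_div]
  have h_nonneg : 0 ≤ ∑ j, y j ^ 2 := Finset.sum_nonneg fun j _ => sq_nonneg _
  gcongr
  exact div_le_one_of_le₀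
    (Finset.single_le_sum (fun j _ => sq_nonneg (y j)) (Finset.mem_univ k)) h_nonneg

lemma integrable_sub_mul_div_sum_sq (hv : v ≠ 0) (hκ : 2 < Fintype.card κ) (k : κ) :
    Integrable (fun y => (y k - m k) * (y k / ∑ j, y j ^ 2))
      (Measure.pi fun i => gaussianReal (m i) v) :=
  (memLp_sub_pi_gaussianReal m v k).integrable_mul (memLp_div_sum_sq_pi_gaussianReal m hv hκ k)

lemma hasDerivAt_div_sum_sq_update [DecidableEq κ] {y : κ → ℝ} {j k : κ} (hjk : j ≠ k)
    (hy : y j ≠ 0) (x : ℝ) :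
    HasDerivAt
      (fun x => Function.update y k x k / ∑ i, Function.update y k x i ^ 2)
      ((∑ i, Function.update y k x i ^ 2)⁻¹ -
        2 * (Function.update y k x k / ∑ i, Function.update y k x i ^ 2) ^ 2) x := by
  have h_sum (x : ℝ) : ∑ i, Function.update y k x i ^ 2 =
      x ^ 2 + ∑ i ∈ Finset.univ.erase k, y i ^ 2 := by
    rw [← Finset.add_sum_erase _ _ (Finset.mem_univ k), Function.update_self]
    congr 1
    exact Finset.sum_congr rfl fun i hi => by
      rw [Function.update_of_ne (Finset.ne_of_mem_erase hi)]
  have h_pos : 0 < ∑ i ∈ Finset.univ.erase k, y i ^ 2 :=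
    Finset.sum_pos' (fun i _ => sq_nonneg (y i)) ⟨j, by simpa using hjk, by positivity⟩
  simp only [h_sum, Function.update_self]
  have h_ne : x ^ 2 + ∑ i ∈ Finset.univ.erase k, y i ^ 2 ≠ 0 := by positivity
  refine ((hasDerivAt_id' x).div ((hasDerivAt_pow 2 x).add_const _) h_ne).congr_deriv ?_
  push_cast
  field_simp

lemma integral_sub_mul_div_sum_sq (hv : v ≠ 0) (hκ : 2 < Fintype.card κ) (k : κ) :
    ∫ y, (y k - m k) * (y k / ∑ j, y j ^ 2) ∂Measure.pi (fun i => gaussianReal (m i) v) =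
      v * (∫ y, (∑ j, y j ^ 2)⁻¹ ∂Measure.pi (fun i => gaussianReal (m i) v) -
        2 * ∫ y, (y k / ∑ j, y j ^ 2) ^ 2 ∂Measure.pi fun i => gaussianReal (m i) v) := by
  classical
  have h_inv := integrable_inv_sum_sq_pi_gaussianReal m hv hκ
  have h_memLp := memLp_div_sum_sq_pi_gaussianReal m hv hκ k
  have : Nontrivial κ := Fintype.one_lt_card_iff_nontrivial.1 (by omega)
  obtain ⟨j, hjk⟩ := exists_ne k
  rw [← integral_const_mul, ← integral_sub h_inv (h_memLp.integrable_sq.const_mul 2)]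
  refine integral_sub_mul_pi_gaussianReal m hv k ?_ (h_memLp.integrable one_le_two)
    (integrable_sub_mul_div_sum_sq m hv hκ k) (h_inv.sub (h_memLp.integrable_sq.const_mul 2))
  have : NullSingletonClass (gaussianReal (m j) v) := nullSingletonClass_gaussianReal hv
  have h_ae : ∀ᵐ y ∂Measure.pi fun i => gaussianReal (m i) v, y j ≠ 0 :=
    (measurePreserving_eval (fun i => gaussianReal (m i) v) j).quasiMeasurePreserving.ae
      (Measure.ae_ne _ 0)
  filter_upwards [h_ae] with y hy x using hasDerivAt_div_sum_sq_update hjk hy x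

/-- The divergence of `y ↦ y / ‖y‖²` is `(card κ - 2) / ‖y‖²`. -/
lemma integral_sum_sub_mul_div_sum_sq (hv : v ≠ 0) (hκ : 2 < Fintype.card κ) :
    ∫ y, ∑ k, (y k - m k) * (y k / ∑ j, y j ^ 2) ∂Measure.pi (fun k => gaussianReal (m k) v) =
      v * (Fintype.card κ - 2) *
        ∫ y, (∑ k, y k ^ 2)⁻¹ ∂Measure.pi fun k => gaussianReal (m k) v := by
  have h_sum (y : κ → ℝ) : ∑ k, (y k / ∑ j, y j ^ 2) ^ 2 = (∑ j, y j ^ 2)⁻¹ := by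
    simp only [div_pow]
    rw [← Finset.sum_div, sq (∑ j, y j ^ 2), div_self_mul_self']
  rw [integral_finsetSum _ fun k _ => integrable_sub_mul_div_sum_sq m hv hκ k]
  simp only [integral_sub_mul_div_sum_sq m hv hκ]
  rw [← Finset.mul_sum, Finset.sum_sub_distrib, ← Finset.mul_sum, ← integral_finsetSum _ fun k _ =>
    (memLp_div_sum_sq_pi_gaussianReal m hv hκ k).integrable_sq]
  simp only [h_sum, Finset.sum_const, Finset.card_univ, nsmul_eq_mul]
  ring

end NoncentralChiSq

section Matrix

variable {ι κ : Type*} [Fintype ι] [DecidableEq ι]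

@[fun_prop]
lemma measurable_toEuclideanLin [Finite κ] (A : Matrix κ ι ℝ) : Measurable A.toEuclideanLin := by
  have := Fintype.ofFinite κ
  exact A.toEuclideanLin.continuous_of_finiteDimensional.measurable

variable [Fintype κ] [DecidableEq κ]

lemma inner_toEuclideanLin_left (A : Matrix κ ι ℝ) (x : EuclideanSpace ℝ ι)
    (y : EuclideanSpace ℝ κ) : ⟪A.toEuclideanLin x, y⟫ = ⟪x, Aᵀ.toEuclideanLin y⟫ := by
  rw [← Matrix.conjTranspose_eq_transpose_of_trivial,
    Matrix.toEuclideanLin_conjTranspose_eq_adjoint, LinearMap.adjoint_inner_right]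

lemma inner_toEuclideanLin_right (A : Matrix κ ι ℝ) (y : EuclideanSpace ℝ κ)
    (x : EuclideanSpace ℝ ι) : ⟪y, A.toEuclideanLin x⟫ = ⟪Aᵀ.toEuclideanLin y, x⟫ := by
  rw [real_inner_comm, inner_toEuclideanLin_left, real_inner_comm]

lemma toEuclideanLin_transpose_toEuclideanLin {W : Matrix ι κ ℝ} (hW : Wᵀ * W = 1)
    (y : EuclideanSpace ℝ κ) : Wᵀ.toEuclideanLin (W.toEuclideanLin y) = y := by
  simp [Matrix.toLpLin_apply, Matrix.mulVec_mulVec, hW]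

omit [DecidableEq ι] in
lemma norm_toEuclideanLin {W : Matrix ι κ ℝ} (hW : Wᵀ * W = 1) (y : EuclideanSpace ℝ κ) :
    ‖W.toEuclideanLin y‖ = ‖y‖ := by
  classical
  rw [← sq_eq_sq₀ (norm_nonneg _) (norm_nonneg _), ← real_inner_self_eq_norm_sq,
    ← real_inner_self_eq_norm_sq, inner_toEuclideanLin_left,
    toEuclideanLin_transpose_toEuclideanLin hW]

lemma det_one_add_smul_conj_diagonal {P : Matrix κ κ ℝ} (hP : Pᵀ * P = 1) (lam : κ → ℝ) (c : ℝ) :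
    (1 + c • (P * Matrix.diagonal lam * Pᵀ)).det = ∏ k, (1 + c * lam k) := by
  rw [mul_assoc, ← mul_smul_comm, Matrix.det_one_add_mul_comm, smul_mul_assoc, mul_assoc, hP,
    mul_one, ← Matrix.det_diagonal]
  congr 1
  ext i j
  by_cases hij : i = j <;> simp [hij]

end Matrix

section MultivariateGaussian

variable {ι κ : Type*} [Fintype ι] [DecidableEq ι] [Fintype κ] [DecidableEq κ]

lemma multivariateGaussian_map_toEuclideanLin {S : Matrix ι ι ℝ} (hS : S.PosSemidef)
    (A : Matrix κ ι ℝ) (μ : EuclideanSpace ℝ ι) :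
    (multivariateGaussian μ S).map A.toEuclideanLin =
      multivariateGaussian (A.toEuclideanLin μ) (A * S * Aᵀ) := by
  have h_meas := measurable_toEuclideanLin A
  have := Measure.isProbabilityMeasure_map (μ := multivariateGaussian μ S) h_meas.aemeasurable
  refine Measure.ext_of_charFun (funext fun t => ?_)
  rw [charFun_apply, integral_map h_meas.aemeasurable (by fun_prop)]
  simp only [inner_toEuclideanLin_left]
  rw [← charFun_apply, charFun_multivariateGaussian hS, charFun_multivariateGaussian
    (by simpa using hS.mul_mul_conjTranspose_same A), real_inner_comm, ← inner_toEuclideanLin_left,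
    real_inner_comm]
  simp only [Matrix.ofLp_toLpLin, Matrix.toLin'_apply, ← Matrix.mulVec_mulVec,
    Matrix.dotProduct_mulVec, Matrix.mulVec_transpose]

lemma pi_gaussianReal_map_toLp (m : κ → ℝ) (v : κ → ℝ≥0) :
    (Measure.pi fun k => gaussianReal (m k) (v k)).map (WithLp.toLp 2) =
      multivariateGaussian (WithLp.toLp 2 m) (Matrix.diagonal fun k => (v k : ℝ)) := by
  have h_diag : (Matrix.diagonal fun k => (v k : ℝ)).PosSemidef :=
    Matrix.posSemidef_diagonal_iff.2 fun k => (v k).2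
  refine Measure.ext_of_charFun (E := EuclideanSpace ℝ κ) (funext fun t => ?_)
  rw [charFun_multivariateGaussian h_diag, charFun_pi]
  simp only [charFun_gaussianReal]
  rw [← Complex.exp_sum, Finset.sum_sub_distrib, ← Finset.sum_mul, ← Finset.sum_div]
  simp only [PiLp.inner_apply, Matrix.mulVec_diagonal, dotProduct]
  push_cast
  simp [mul_comm, mul_left_comm, sq]

lemma multivariateGaussian_conv {S T : Matrix ι ι ℝ} (hS : S.PosSemidef) (hT : T.PosSemidef)
    (μ ν : EuclideanSpace ℝ ι) :
    multivariateGaussian μ S ∗ multivariateGaussian ν T = multivariateGaussian (μ + ν) (S + T) := by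
  refine Measure.ext_of_charFun (funext fun t => ?_)
  rw [charFun_conv, charFun_multivariateGaussian hS, charFun_multivariateGaussian hT,
    charFun_multivariateGaussian (hS.add hT), ← Complex.exp_add, inner_add_right,
    Matrix.add_mulVec, dotProduct_add]
  push_cast
  ring_nf

lemma multivariateGaussian_map_const_add (μ ν : EuclideanSpace ℝ ι) (S : Matrix ι ι ℝ) :
    (multivariateGaussian ν S).map (μ + ·) = multivariateGaussian (μ + ν) S := by
  rw [multivariateGaussian, multivariateGaussian, Measure.map_map (by fun_prop) (by fun_prop)]
  simp only [Function.comp_def, add_assoc]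

lemma mgf_norm_sq_multivariateGaussian_conj_diagonal {P : Matrix κ κ ℝ} (hP : Pᵀ * P = 1)
    (lam : κ → ℝ≥0) {t : ℝ} (ht : 0 ≤ t) :
    mgf (fun y => ‖y‖ ^ 2)
        (multivariateGaussian 0 (P * Matrix.diagonal (fun k => (lam k : ℝ)) * Pᵀ)) (-t) =
      ∏ k, (√(1 + 2 * t * lam k))⁻¹ := by
  have h_diag : (Matrix.diagonal fun k => (lam k : ℝ)).PosSemidef :=
    Matrix.posSemidef_diagonal_iff.2 fun k => (lam k).2
  have h_law : multivariateGaussian 0 (P * Matrix.diagonal (fun k => (lam k : ℝ)) * Pᵀ) =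
      (Measure.pi fun k => gaussianReal ((0 : κ → ℝ) k) (lam k)).map
        (P.toEuclideanLin ∘ WithLp.toLp 2) := by
    rw [← Measure.map_map (by fun_prop) (by fun_prop), pi_gaussianReal_map_toLp,
      multivariateGaussian_map_toEuclideanLin h_diag]
    simp
  have h_lt (k : κ) : 2 * -t * (lam k : ℝ) < 1 := by
    nlinarith [mul_nonneg ht (lam k).coe_nonneg]
  rw [mgf, h_law, integral_map (by fun_prop) (by fun_prop)]
  simp only [Function.comp_apply, norm_toEuclideanLin hP, EuclideanSpace.norm_sq_eq,
    Real.norm_eq_abs, sq_abs]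
  refine (mgf_sum_sq_pi_gaussianReal 0 lam h_lt).trans (Finset.prod_congr rfl fun k _ => ?_)
  simp [sub_neg_eq_add]

lemma mgf_norm_sq_multivariateGaussian {V : Matrix κ κ ℝ} (hV : V.PosSemidef) {t : ℝ}
    (ht : 0 ≤ t) :
    mgf (fun y => ‖y‖ ^ 2) (multivariateGaussian 0 V) (-t) = (√(1 + (2 * t) • V).det)⁻¹ := by
  let U : Matrix κ κ ℝ := hV.1.eigenvectorUnitary
  let lam : κ → ℝ≥0 := fun k => ⟨hV.1.eigenvalues k, hV.eigenvalues_nonneg k⟩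
  have hU : Uᵀ * U = 1 := by
    simpa [Matrix.star_eq_conjTranspose] using Unitary.coe_star_mul_self hV.1.eigenvectorUnitary
  have h_spectral : V = U * Matrix.diagonal (fun k => (lam k : ℝ)) * Uᵀ := by
    have h := hV.1.spectral_theorem
    rw [Unitary.conjStarAlgAut_apply, Matrix.star_eq_conjTranspose,
      Matrix.conjTranspose_eq_transpose_of_trivial] at h
    exact h
  rw [h_spectral, mgf_norm_sq_multivariateGaussian_conj_diagonal hU lam ht,
    det_one_add_smul_conj_diagonal hU, Real.sqrt_prod, Finset.prod_inv_distrib]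
  intro k _
  positivity

end MultivariateGaussian

section Substitution

variable {c : ℝ}

lemma image_inv_sub_one_div_Ioo (hc : 0 < c) :
    (fun u : ℝ => (u⁻¹ - 1) / c) '' Set.Ioo 0 1 = Set.Ioi 0 := by
  ext t
  simp only [Set.mem_image, Set.mem_Ioo, Set.mem_Ioi]
  constructor
  · rintro ⟨u, ⟨hu₀, hu₁⟩, rfl⟩
    exact div_pos (sub_pos.2 ((one_lt_inv₀ hu₀).2 hu₁)) hc
  · intro ht
    have h_lt : 1 < c * t + 1 := by linarith [mul_pos hc ht]
    exact ⟨(c * t + 1)⁻¹, ⟨by positivity, inv_lt_one_of_one_lt₀ h_lt⟩, by field_simp; simp⟩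

lemma injective_inv_sub_one_div (hc : c ≠ 0) : Function.Injective fun u : ℝ => (u⁻¹ - 1) / c :=
  fun _ _ h => inv_injective (sub_left_injective ((div_left_inj' hc).1 h))

lemma hasDerivAt_inv_sub_one_div (c : ℝ) {u : ℝ} (hu : u ≠ 0) :
    HasDerivAt (fun u : ℝ => (u⁻¹ - 1) / c) (-(c * u ^ 2)⁻¹) u := by
  refine (((hasDerivAt_inv hu).sub_const 1).div_const c).congr_deriv ?_
  rw [mul_inv_rev, neg_div, div_eq_mul_inv]

lemma abs_neg_inv_mul_sq (hc : 0 < c) (u : ℝ) : |-(c * u ^ 2)⁻¹| = (c * u ^ 2)⁻¹ := by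
  rw [abs_neg, abs_of_nonneg (by positivity)]

lemma integrableOn_Ioi_iff_integrableOn_Ioo (hc : 0 < c) (f : ℝ → ℝ) :
    IntegrableOn f (Set.Ioi 0) ↔
      IntegrableOn (fun u => (c * u ^ 2)⁻¹ * f ((u⁻¹ - 1) / c)) (Set.Ioo 0 1) := by
  rw [← image_inv_sub_one_div_Ioo hc, integrableOn_image_iff_integrableOn_abs_deriv_smul
    measurableSet_Ioo (fun u hu => (hasDerivAt_inv_sub_one_div c hu.1.ne').hasDerivWithinAt)
    (injective_inv_sub_one_div hc.ne').injOn]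
  simp only [abs_neg_inv_mul_sq hc, smul_eq_mul]

lemma integral_Ioi_eq_integral_Ioo (hc : 0 < c) (f : ℝ → ℝ) :
    ∫ t in Set.Ioi 0, f t = ∫ u in Set.Ioo 0 1, (c * u ^ 2)⁻¹ * f ((u⁻¹ - 1) / c) := by
  rw [← image_inv_sub_one_div_Ioo hc, integral_image_eq_integral_abs_deriv_smul
    measurableSet_Ioo (fun u hu => (hasDerivAt_inv_sub_one_div c hu.1.ne').hasDerivWithinAt)
    (injective_inv_sub_one_div hc.ne').injOn]
  simp only [abs_neg_inv_mul_sq hc, smul_eq_mul]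

lemma intervalIntegrable_rpow_div_sqrt {r : ℝ} (hr : -1 < r) {ξ : ℝ → ℝ}
    (hξ : ContinuousOn ξ (Set.Icc 0 1)) (hξ_pos : ∀ u ∈ Set.Icc (0 : ℝ) 1, 0 < ξ u) :
    IntervalIntegrable (fun u => u ^ r / √(ξ u)) volume 0 1 := by
  simp only [div_eq_mul_inv]
  refine (intervalIntegral.intervalIntegrable_rpow' hr).mul_continuousOn ?_
  rw [Set.uIcc_of_le zero_le_one]
  exact hξ.sqrt.inv₀ fun u hu => (Real.sqrt_pos.2 (hξ_pos u hu)).ne'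

end Substitution

section InverseMomentGaussian

variable {κ : Type*} [Fintype κ] [DecidableEq κ] {V : Matrix κ κ ℝ} {v : ℝ≥0}

lemma det_one_add_smul_pos (hV : V.PosSemidef) {c : ℝ} (hc : 0 ≤ c) : 0 < (1 + c • V).det :=
  (Matrix.PosDef.one.add_posSemidef (hV.smul hc)).det_pos

lemma intervalIntegrable_rpow_div_sqrt_det (hV : V.PosSemidef) {c : ℝ} (hc : 0 ≤ c) {r : ℝ}
    (hr : -1 < r) :
    IntervalIntegrable (fun u => u ^ r / √(1 + (c * (1 - u)) • V).det) volume 0 1 :=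
  intervalIntegrable_rpow_div_sqrt hr (Continuous.continuousOn (by fun_prop)) fun _ hu =>
    det_one_add_smul_pos hV (mul_nonneg hc (sub_nonneg.2 hu.2))

lemma mgf_norm_sq_multivariateGaussian_add_smul_one (hV : V.PosSemidef) (hv : v ≠ 0) {u : ℝ}
    (hu : u ∈ Set.Ioo 0 1) :
    (2 * v * u ^ 2)⁻¹ * mgf (fun y => ‖y‖ ^ 2) (multivariateGaussian 0 (V + (v : ℝ) • 1))
        (-((u⁻¹ - 1) / (2 * v))) =
      (2 * v : ℝ)⁻¹ * (u ^ (((Fintype.card κ : ℝ) - 2) / 2 - 1) /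
        √(1 + ((v : ℝ)⁻¹ * (1 - u)) • V).det) := by
  obtain ⟨hu₀, hu₁⟩ := hu
  have hv₀ : (0 : ℝ) < v := by positivity
  have h_nonneg : 0 ≤ (u⁻¹ - 1) / (2 * v) :=
    div_nonneg (sub_nonneg.2 ((one_le_inv₀ hu₀).2 hu₁.le)) (by positivity)
  have h_matrix : 1 + (2 * ((u⁻¹ - 1) / (2 * v))) • (V + (v : ℝ) • 1) =
      u⁻¹ • (1 + ((v : ℝ)⁻¹ * (1 - u)) • V) := by
    ext i j
    simp only [Matrix.add_apply, Matrix.smul_apply, smul_eq_mul]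
    field_simp
    ring
  have h_rpow : √(u⁻¹ ^ Fintype.card κ) =
      (u ^ (((Fintype.card κ : ℝ) - 2) / 2 - 1) * u ^ 2)⁻¹ := by
    rw [inv_pow, Real.sqrt_inv, Real.sqrt_eq_rpow, ← Real.rpow_natCast, ← Real.rpow_mul hu₀.le,
      ← Real.rpow_natCast u 2, ← Real.rpow_add hu₀]
    congr 2
    push_cast
    ring
  rw [mgf_norm_sq_multivariateGaussian (hV.add (Matrix.PosSemidef.one.smul hv₀.le)) h_nonneg,
    h_matrix, Matrix.det_smul, Real.sqrt_mul (by positivity), h_rpow]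
  field_simp

lemma integrableOn_mgf_norm_sq_multivariateGaussian (hV : V.PosSemidef) (hv : v ≠ 0)
    (hκ : 2 < Fintype.card κ) :
    IntegrableOn
      (fun t => mgf (fun y => ‖y‖ ^ 2) (multivariateGaussian 0 (V + (v : ℝ) • 1)) (-t))
      (Set.Ioi 0) := by
  have hκ' : (2 : ℝ) < Fintype.card κ := by exact_mod_cast hκ
  rw [integrableOn_Ioi_iff_integrableOn_Ioo (c := 2 * v) (by positivity),
    integrableOn_congr_fun (fun u hu => mgf_norm_sq_multivariateGaussian_add_smul_one hV hv hu)
      measurableSet_Ioo, ← intervalIntegrable_iff_integrableOn_Ioo_of_le zero_le_one]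
  exact (intervalIntegrable_rpow_div_sqrt_det hV (by positivity) (by linarith)).const_mul _

lemma integrable_inv_norm_sq_multivariateGaussian (hV : V.PosSemidef) (hv : v ≠ 0)
    (hκ : 2 < Fintype.card κ) :
    Integrable (fun y => (‖y‖ ^ 2)⁻¹) (multivariateGaussian 0 (V + (v : ℝ) • 1)) :=
  integrable_inv_of_integrableOn_mgf (by fun_prop) (fun _ => by positivity)
    (integrableOn_mgf_norm_sq_multivariateGaussian hV hv hκ)

lemma integral_inv_norm_sq_multivariateGaussian (hV : V.PosSemidef) (hv : v ≠ 0)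
    (hκ : 2 < Fintype.card κ) :
    ∫ y, (‖y‖ ^ 2)⁻¹ ∂multivariateGaussian 0 (V + (v : ℝ) • 1) =
      (2 * v : ℝ)⁻¹ * ∫ u in (0 : ℝ)..1, u ^ (((Fintype.card κ : ℝ) - 2) / 2 - 1) /
        √(1 + ((v : ℝ)⁻¹ * (1 - u)) • V).det := by
  rw [integral_inv_eq_integral_mgf (by fun_prop) (fun _ => by positivity)
      (integrableOn_mgf_norm_sq_multivariateGaussian hV hv hκ),
    integral_Ioi_eq_integral_Ioo (c := 2 * v) (by positivity),
    setIntegral_congr_fun measurableSet_Ioo fun u hu =>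
      mgf_norm_sq_multivariateGaussian_add_smul_one hV hv hu,
    integral_const_mul, intervalIntegral.integral_of_le zero_le_one, integral_Ioc_eq_integral_Ioo]

end InverseMomentGaussian

section SteinEuclideanSpace

variable {κ : Type*} [Fintype κ]

lemma inner_toLp_sub_div_norm_sq (m : EuclideanSpace ℝ κ) (y : κ → ℝ) :
    ⟪WithLp.toLp 2 y - m, WithLp.toLp 2 y⟫ / ‖WithLp.toLp 2 y‖ ^ 2 =
      ∑ k, (y k - m k) * (y k / ∑ j, y j ^ 2) := by
  rw [PiLp.inner_apply, EuclideanSpace.real_norm_sq_eq, Finset.sum_div]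
  exact Finset.sum_congr rfl fun k _ => by simp; ring

variable [DecidableEq κ]

lemma measurePreserving_toLp_pi_gaussianReal (m : EuclideanSpace ℝ κ) (v : ℝ≥0) :
    MeasurePreserving (MeasurableEquiv.toLp 2 (κ → ℝ))
      (Measure.pi fun k => gaussianReal (m k) v) (multivariateGaussian m ((v : ℝ) • 1)) := by
  refine ⟨by fun_prop, ?_⟩
  rw [Matrix.smul_one_eq_diagonal]
  exact pi_gaussianReal_map_toLp (fun k => m k) fun _ => v

lemma integrable_norm_sub_sq_multivariateGaussian (m : EuclideanSpace ℝ κ) (v : ℝ≥0) :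
    Integrable (fun y => ‖y - m‖ ^ 2) (multivariateGaussian m ((v : ℝ) • 1)) := by
  rw [← (measurePreserving_toLp_pi_gaussianReal m v).integrable_comp_emb
    (MeasurableEquiv.measurableEmbedding _)]
  simp only [Function.comp_def, EuclideanSpace.real_norm_sq_eq]
  exact integrable_finsetSum _ fun k _ => (memLp_sub_pi_gaussianReal _ v k).integrable_sq

lemma integral_norm_sub_sq_multivariateGaussian (m : EuclideanSpace ℝ κ) (v : ℝ≥0) :
    ∫ y, ‖y - m‖ ^ 2 ∂multivariateGaussian m ((v : ℝ) • 1) = Fintype.card κ * v := by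
  have h_coord (k : κ) : ∫ y, (y k - m k) ^ 2 ∂Measure.pi (fun k => gaussianReal (m k) v) = v := by
    rw [integral_comp_eval (μ := fun k => gaussianReal (m k) v) (f := fun x => (x - m k) ^ 2)
      (by fun_prop)]
    simpa using (variance_eq_integral (μ := gaussianReal (m k) v) aemeasurable_id).symm
  rw [← (measurePreserving_toLp_pi_gaussianReal m v).integral_comp
    (MeasurableEquiv.measurableEmbedding _)]
  simp only [EuclideanSpace.real_norm_sq_eq]
  refine (integral_finsetSum _ fun k _ =>
    (memLp_sub_pi_gaussianReal _ v k).integrable_sq).trans ?_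
  simp [h_coord]

variable (m : EuclideanSpace ℝ κ) {v : ℝ≥0}

lemma integrable_inv_norm_sq_multivariateGaussian_smul_one (hv : v ≠ 0)
    (hκ : 2 < Fintype.card κ) :
    Integrable (fun y => (‖y‖ ^ 2)⁻¹) (multivariateGaussian m ((v : ℝ) • 1)) := by
  rw [← (measurePreserving_toLp_pi_gaussianReal m v).integrable_comp_emb
    (MeasurableEquiv.measurableEmbedding _)]
  simp only [Function.comp_def, EuclideanSpace.real_norm_sq_eq]
  exact integrable_inv_sum_sq_pi_gaussianReal _ hv hκ

lemma integrable_inner_sub_div_norm_sq (hv : v ≠ 0) (hκ : 2 < Fintype.card κ) :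
    Integrable (fun y => ⟪y - m, y⟫ / ‖y‖ ^ 2) (multivariateGaussian m ((v : ℝ) • 1)) := by
  rw [← (measurePreserving_toLp_pi_gaussianReal m v).integrable_comp_emb
    (MeasurableEquiv.measurableEmbedding _)]
  simp only [Function.comp_def, MeasurableEquiv.toLp_apply, inner_toLp_sub_div_norm_sq]
  exact integrable_finsetSum _ fun k _ => integrable_sub_mul_div_sum_sq _ hv hκ k

lemma integral_inner_sub_div_norm_sq (hv : v ≠ 0) (hκ : 2 < Fintype.card κ) :
    ∫ y, ⟪y - m, y⟫ / ‖y‖ ^ 2 ∂multivariateGaussian m ((v : ℝ) • 1) =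
      v * (Fintype.card κ - 2) *
        ∫ y, (‖y‖ ^ 2)⁻¹ ∂multivariateGaussian m ((v : ℝ) • 1) := by
  simp only [← (measurePreserving_toLp_pi_gaussianReal m v).integral_comp
    (MeasurableEquiv.measurableEmbedding _), MeasurableEquiv.toLp_apply, inner_toLp_sub_div_norm_sq]
  simp only [EuclideanSpace.real_norm_sq_eq]
  exact integral_sum_sub_mul_div_sum_sq _ hv hκ

end SteinEuclideanSpace

section JamesStein

variable {ι κ : Type*} [Fintype ι] [DecidableEq ι] [Fintype κ] [DecidableEq κ]
  {W : Matrix ι κ ℝ} {v : ℝ≥0}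

/-- The James–Stein estimator of the mean of a `N(μ, v • 1)` vector `x` that shrinks the
coordinates `Wᵀ x` of `x` in the column space of `W` towards the origin and leaves the orthogonal
complement of that space unchanged; the columns of `W` are meant to be orthonormal. -/
noncomputable def jamesStein (W : Matrix ι κ ℝ) (v : ℝ) (x : EuclideanSpace ℝ ι) :
    EuclideanSpace ℝ ι :=
  x - (v * (Fintype.card κ - 2) / ‖Wᵀ.toEuclideanLin x‖ ^ 2) •
    W.toEuclideanLin (Wᵀ.toEuclideanLin x)

@[fun_prop]
lemma measurable_jamesStein (W : Matrix ι κ ℝ) (v : ℝ) : Measurable (jamesStein W v) := by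
  unfold jamesStein
  fun_prop

lemma norm_sq_jamesStein_sub (hW : Wᵀ * W = 1) (v : ℝ) (x μ : EuclideanSpace ℝ ι) :
    ‖jamesStein W v x - μ‖ ^ 2 =
      ‖x - μ‖ ^ 2 -
        2 * (v * (Fintype.card κ - 2)) *
          (⟪Wᵀ.toEuclideanLin x - Wᵀ.toEuclideanLin μ, Wᵀ.toEuclideanLin x⟫ /
            ‖Wᵀ.toEuclideanLin x‖ ^ 2) +
        (v * (Fintype.card κ - 2)) ^ 2 * (‖Wᵀ.toEuclideanLin x‖ ^ 2)⁻¹ := by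
  rw [jamesStein, sub_right_comm, norm_sub_sq_real, inner_smul_right, ← map_sub,
    ← inner_toEuclideanLin_right, norm_smul, norm_toEuclideanLin hW, mul_pow, Real.norm_eq_abs,
    sq_abs]
  rcases eq_or_ne ‖Wᵀ.toEuclideanLin x‖ 0 with h | h
  · simp [h]
  · field_simp

lemma measurePreserving_transpose_toEuclideanLin (hW : Wᵀ * W = 1) (v : ℝ≥0)
    (μ : EuclideanSpace ℝ ι) :
    MeasurePreserving Wᵀ.toEuclideanLin (multivariateGaussian μ ((v : ℝ) • 1))
      (multivariateGaussian (Wᵀ.toEuclideanLin μ) ((v : ℝ) • 1)) := by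
  refine ⟨by fun_prop, ?_⟩
  rw [multivariateGaussian_map_toEuclideanLin (Matrix.PosSemidef.one.smul v.coe_nonneg)]
  simp [hW]

variable (hW : Wᵀ * W = 1) (hv : v ≠ 0) (hκ : 2 < Fintype.card κ) (μ : EuclideanSpace ℝ ι)

include hW hv hκ

lemma integrable_inner_transpose_sub_div_norm_sq :
    Integrable
      (fun x => ⟪Wᵀ.toEuclideanLin x - Wᵀ.toEuclideanLin μ, Wᵀ.toEuclideanLin x⟫ /
        ‖Wᵀ.toEuclideanLin x‖ ^ 2) (multivariateGaussian μ ((v : ℝ) • 1)) :=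
  (measurePreserving_transpose_toEuclideanLin hW v μ).integrable_comp_of_integrable
    (integrable_inner_sub_div_norm_sq _ hv hκ)

lemma integrable_inv_norm_sq_transpose :
    Integrable (fun x => (‖Wᵀ.toEuclideanLin x‖ ^ 2)⁻¹)
      (multivariateGaussian μ ((v : ℝ) • 1)) :=
  (measurePreserving_transpose_toEuclideanLin hW v μ).integrable_comp_of_integrable
    (integrable_inv_norm_sq_multivariateGaussian_smul_one _ hv hκ)

lemma integral_inner_transpose_sub_div_norm_sq :
    ∫ x, ⟪Wᵀ.toEuclideanLin x - Wᵀ.toEuclideanLin μ, Wᵀ.toEuclideanLin x⟫ /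
        ‖Wᵀ.toEuclideanLin x‖ ^ 2 ∂multivariateGaussian μ ((v : ℝ) • 1) =
      v * (Fintype.card κ - 2) *
        ∫ x, (‖Wᵀ.toEuclideanLin x‖ ^ 2)⁻¹ ∂multivariateGaussian μ ((v : ℝ) • 1) := by
  have h_stein := integral_inner_sub_div_norm_sq (Wᵀ.toEuclideanLin μ) hv hκ
  rwa [← (measurePreserving_transpose_toEuclideanLin hW v μ).map_eq,
    integral_map (by fun_prop) (Measurable.aestronglyMeasurable (by fun_prop)),
    integral_map (by fun_prop) (by fun_prop)] at h_stein

lemma integrable_norm_sq_jamesStein_sub :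
    Integrable (fun x => ‖jamesStein W v x - μ‖ ^ 2) (multivariateGaussian μ ((v : ℝ) • 1)) := by
  simp only [norm_sq_jamesStein_sub hW]
  exact ((integrable_norm_sub_sq_multivariateGaussian μ v).sub
    ((integrable_inner_transpose_sub_div_norm_sq hW hv hκ μ).const_mul _)).add
      ((integrable_inv_norm_sq_transpose hW hv hκ μ).const_mul _)

lemma integral_norm_sq_jamesStein_sub :
    ∫ x, ‖jamesStein W v x - μ‖ ^ 2 ∂multivariateGaussian μ ((v : ℝ) • 1) =
      Fintype.card ι * v - (v * (Fintype.card κ - 2)) ^ 2 *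
        ∫ x, (‖Wᵀ.toEuclideanLin x‖ ^ 2)⁻¹ ∂multivariateGaussian μ ((v : ℝ) • 1) := by
  have h_int := integrable_norm_sub_sq_multivariateGaussian μ v
  have h_inner_int := (integrable_inner_transpose_sub_div_norm_sq hW hv hκ μ).const_mul
    (2 * (v * (Fintype.card κ - 2)))
  have h_inv_int := (integrable_inv_norm_sq_transpose hW hv hκ μ).const_mul
    ((v * (Fintype.card κ - 2)) ^ 2)
  simp only [norm_sq_jamesStein_sub hW]
  rw [integral_add (h_int.sub' h_inner_int) h_inv_int, integral_sub h_int h_inner_int,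
    integral_const_mul, integral_const_mul, integral_inner_transpose_sub_div_norm_sq hW hv hκ,
    integral_norm_sub_sq_multivariateGaussian]
  ring

end JamesStein

section GaussianPrior

variable {ι κ : Type*} [Fintype ι]

lemma posSemidef_transpose_mul_mul_same [Finite κ] {S : Matrix ι ι ℝ} (hS : S.PosSemidef)
    (W : Matrix ι κ ℝ) : (Wᵀ * S * W).PosSemidef := by
  simpa using hS.conjTranspose_mul_mul_same W

variable [DecidableEq ι] [Fintype κ] [DecidableEq κ]

lemma integral_multivariateGaussian_eq_integral_const_add (μ : EuclideanSpace ℝ ι)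
    (S : Matrix ι ι ℝ) (f : EuclideanSpace ℝ ι → ℝ) :
    ∫ x, f x ∂multivariateGaussian μ S = ∫ x, f (μ + x) ∂multivariateGaussian 0 S := by
  rw [← (measurableEmbedding_addLeft μ).integral_map, multivariateGaussian_map_const_add, add_zero]

lemma integrable_integral_multivariateGaussian {S T : Matrix ι ι ℝ} (hS : S.PosSemidef)
    (hT : T.PosSemidef) {f : EuclideanSpace ℝ ι → ℝ}
    (hf : Integrable f (multivariateGaussian 0 (S + T))) :
    Integrable (fun μ => ∫ x, f x ∂multivariateGaussian μ T) (multivariateGaussian 0 S) := by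
  rw [← add_zero (0 : EuclideanSpace ℝ ι), ← multivariateGaussian_conv hS hT] at hf
  refine (Integrable.integral_prod_left (f := fun p => f (p.1 + p.2))
    ((integrable_map_measure hf.1 (by fun_prop)).1 hf)).congr (ae_of_all _ fun μ => ?_)
  exact (integral_multivariateGaussian_eq_integral_const_add μ T f).symm

lemma integral_integral_multivariateGaussian {S T : Matrix ι ι ℝ} (hS : S.PosSemidef)
    (hT : T.PosSemidef) {f : EuclideanSpace ℝ ι → ℝ}
    (hf : Integrable f (multivariateGaussian 0 (S + T))) :
    ∫ μ, ∫ x, f x ∂multivariateGaussian μ T ∂multivariateGaussian 0 S =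
      ∫ x, f x ∂multivariateGaussian 0 (S + T) := by
  have h_conv := multivariateGaussian_conv hS hT 0 0
  rw [add_zero] at h_conv
  rw [← h_conv] at hf ⊢
  rw [integral_conv hf]
  exact integral_congr_ae (ae_of_all _ fun μ =>
    integral_multivariateGaussian_eq_integral_const_add μ T f)

variable {S : Matrix ι ι ℝ} {W : Matrix ι κ ℝ} {v : ℝ≥0} (hS : S.PosSemidef) (hW : Wᵀ * W = 1)

include hS hW

lemma measurePreserving_transpose_toEuclideanLin_marginal (v : ℝ≥0) :
    MeasurePreserving Wᵀ.toEuclideanLin (multivariateGaussian 0 (S + (v : ℝ) • 1))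
      (multivariateGaussian 0 (Wᵀ * S * W + (v : ℝ) • 1)) := by
  refine ⟨by fun_prop, ?_⟩
  rw [multivariateGaussian_map_toEuclideanLin (hS.add (Matrix.PosSemidef.one.smul v.coe_nonneg))]
  simp [Matrix.mul_add, Matrix.add_mul, hW]

variable (hv : v ≠ 0) (hκ : 2 < Fintype.card κ)

include hv hκ

lemma integrable_inv_norm_sq_transpose_marginal :
    Integrable (fun x => (‖Wᵀ.toEuclideanLin x‖ ^ 2)⁻¹)
      (multivariateGaussian 0 (S + (v : ℝ) • 1)) :=
  (measurePreserving_transpose_toEuclideanLin_marginal hS hW v).integrable_comp_of_integrable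
    (integrable_inv_norm_sq_multivariateGaussian (posSemidef_transpose_mul_mul_same hS W) hv hκ)

lemma integral_inv_norm_sq_transpose_marginal :
    ∫ x, (‖Wᵀ.toEuclideanLin x‖ ^ 2)⁻¹ ∂multivariateGaussian 0 (S + (v : ℝ) • 1) =
      (2 * v : ℝ)⁻¹ * ∫ u in (0 : ℝ)..1, u ^ (((Fintype.card κ : ℝ) - 2) / 2 - 1) /
        √(1 + ((v : ℝ)⁻¹ * (1 - u)) • (Wᵀ * S * W)).det := by
  rw [← integral_inv_norm_sq_multivariateGaussian (posSemidef_transpose_mul_mul_same hS W) hv hκ,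
    ← (measurePreserving_transpose_toEuclideanLin_marginal hS hW v).map_eq,
    integral_map (by fun_prop) (by fun_prop)]

lemma integrable_integral_norm_sq_jamesStein_sub :
    Integrable (fun μ => ∫ x, ‖jamesStein W v x - μ‖ ^ 2 ∂multivariateGaussian μ ((v : ℝ) • 1))
      (multivariateGaussian 0 S) := by
  simp only [integral_norm_sq_jamesStein_sub hW hv hκ]
  exact (integrable_const _).sub ((integrable_integral_multivariateGaussian hS
    (Matrix.PosSemidef.one.smul v.coe_nonneg)
    (integrable_inv_norm_sq_transpose_marginal hS hW hv hκ)).const_mul _)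

lemma integral_integral_norm_sq_jamesStein_sub :
    ∫ μ, ∫ x, ‖jamesStein W v x - μ‖ ^ 2 ∂multivariateGaussian μ ((v : ℝ) • 1)
        ∂multivariateGaussian 0 S =
      Fintype.card ι * v - v * ((Fintype.card κ : ℝ) - 2) ^ 2 / 2 *
        ∫ u in (0 : ℝ)..1, u ^ (((Fintype.card κ : ℝ) - 2) / 2 - 1) /
          √(1 + ((v : ℝ)⁻¹ * (1 - u)) • (Wᵀ * S * W)).det := by
  have hT : ((v : ℝ) • (1 : Matrix ι ι ℝ)).PosSemidef :=
    Matrix.PosSemidef.one.smul v.coe_nonneg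
  have h_inv_int := integrable_inv_norm_sq_transpose_marginal hS hW hv hκ
  simp only [integral_norm_sq_jamesStein_sub hW hv hκ]
  rw [integral_sub (integrable_const _)
      ((integrable_integral_multivariateGaussian hS hT h_inv_int).const_mul _),
    integral_const, integral_const_mul, integral_integral_multivariateGaussian hS hT h_inv_int,
    integral_inv_norm_sq_transpose_marginal hS hW hv hκ, probReal_univ, one_smul]
  field_simp

end GaussianPrior

section Data

variable {n d : ℕ}

instance isProbabilityMeasure_dataLaw (n : ℕ) (μ : EuclideanSpace ℝ (Fin d)) :
    IsProbabilityMeasure (dataLaw n μ) := by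
  unfold dataLaw
  infer_instance

/-- The vector of the sample means of the `d` populations: the sufficient statistic of which the
estimators are functions. -/
noncomputable def meanVec (Y : Data n d) : EuclideanSpace ℝ (Fin d) :=
  WithLp.toLp 2 (popMean Y)

@[fun_prop]
lemma measurable_meanVec : Measurable (meanVec : Data n d → EuclideanSpace ℝ (Fin d)) := by
  unfold meanVec popMean
  fun_prop

lemma exp_inner_meanVec (Y : Data n d) (t : EuclideanSpace ℝ (Fin d)) :
    Complex.exp (⟪meanVec Y, t⟫ * Complex.I) =
      ∏ i, ∏ j, Complex.exp ((t j / n : ℝ) * Y i j * Complex.I) := by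
  simp only [← Complex.exp_sum]
  rw [Finset.sum_comm]
  simp only [meanVec, popMean, PiLp.inner_apply, RCLike.inner_apply, conj_trivial]
  push_cast
  rw [Finset.sum_mul]
  congr 1
  refine Finset.sum_congr rfl fun j _ => ?_
  rw [← Finset.sum_mul, ← Finset.mul_sum]
  ring

lemma measurePreserving_meanVec (hn : n ≠ 0) (μ : EuclideanSpace ℝ (Fin d)) :
    MeasurePreserving meanVec (dataLaw n μ)
      (multivariateGaussian μ (((n⁻¹ : ℝ≥0) : ℝ) • 1)) := by
  refine ⟨by fun_prop, ?_⟩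
  have := Measure.isProbabilityMeasure_map (μ := dataLaw n μ)
    (measurable_meanVec (n := n) (d := d)).aemeasurable
  refine Measure.ext_of_charFun (funext fun t => ?_)
  rw [charFun_apply, integral_map (by fun_prop) (by fun_prop),
    charFun_multivariateGaussian (Matrix.PosSemidef.one.smul (NNReal.coe_nonneg _))]
  simp only [exp_inner_meanVec]
  rw [dataLaw, integral_fintype_prod_eq_prod (f := fun (_ : Fin n) (y : Fin d → ℝ) =>
    ∏ j, Complex.exp ((t j / n : ℝ) * y j * Complex.I))]
  simp only [integral_fintype_prod_eq_prod (f := fun (j : Fin d) (y : ℝ) =>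
    Complex.exp ((t j / n : ℝ) * y * Complex.I)), ← charFun_apply_real, charFun_gaussianReal]
  rw [Finset.prod_const, Finset.card_univ, Fintype.card_fin, ← Complex.exp_sum,
    ← Complex.exp_nat_mul, Finset.sum_sub_distrib, mul_sub]
  simp only [PiLp.inner_apply, RCLike.inner_apply, conj_trivial, Matrix.smul_mulVec,
    Matrix.one_mulVec, dotProduct, Pi.smul_apply, smul_eq_mul]
  push_cast
  simp only [Finset.mul_sum, Finset.sum_mul, Finset.sum_div]
  congr 2 <;> refine Finset.sum_congr rfl fun j _ => ?_ <;> field_simp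

end Data

section Risk

variable {n d : ℕ} {κ : Type*} [Fintype κ] [DecidableEq κ] {W : Matrix (Fin d) κ ℝ}
  (hn : n ≠ 0) (hW : Wᵀ * W = 1) (hκ : 2 < Fintype.card κ)

include hn

lemma risk_jamesStein (W : Matrix (Fin d) κ ℝ) (μ : EuclideanSpace ℝ (Fin d)) :
    risk (fun Y : Data n d => jamesStein W (n : ℝ)⁻¹ (meanVec Y)) μ =
      ∫ x, ‖jamesStein W (n⁻¹ : ℝ≥0) x - μ‖ ^ 2
        ∂multivariateGaussian μ (((n⁻¹ : ℝ≥0) : ℝ) • 1) := by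
  rw [← (measurePreserving_meanVec hn μ).map_eq, integral_map (by fun_prop) (by fun_prop)]
  simp [risk, loss]

include hW hκ

lemma finiteIntegratedRisk_jamesStein {S : Matrix (Fin d) (Fin d) ℝ} (hS : S.PosSemidef) :
    FiniteIntegratedRisk (fun Y : Data n d => jamesStein W (n : ℝ)⁻¹ (meanVec Y))
      (multivariateGaussian 0 S) := by
  have hn' : (n⁻¹ : ℝ≥0) ≠ 0 := by simpa using hn
  constructor
  · intro μ
    have h := (measurePreserving_meanVec hn μ).integrable_comp_of_integrable
      (integrable_norm_sq_jamesStein_sub hW hn' hκ μ)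
    rwa [NNReal.coe_inv, NNReal.coe_natCast] at h
  · simp only [funext (risk_jamesStein hn W)]
    exact integrable_integral_norm_sq_jamesStein_sub hS hW hn' hκ

lemma integratedRisk_jamesStein {S : Matrix (Fin d) (Fin d) ℝ} (hS : S.PosSemidef) :
    integratedRisk (fun Y : Data n d => jamesStein W (n : ℝ)⁻¹ (meanVec Y))
        (multivariateGaussian 0 S) =
      d / n - ((Fintype.card κ : ℝ) - 2) ^ 2 / (2 * n) *
        ∫ u in (0 : ℝ)..1, u ^ (((Fintype.card κ : ℝ) - 2) / 2 - 1) /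
          √(1 + (n * (1 - u)) • (Wᵀ * S * W)).det := by
  have hn' : (n⁻¹ : ℝ≥0) ≠ 0 := by simpa using hn
  simp only [integratedRisk, risk_jamesStein hn W]
  rw [integral_integral_norm_sq_jamesStein_sub hS hW hn' hκ, Fintype.card_fin]
  push_cast
  rw [inv_inv]
  field_simp

end Risk

section Estimators

variable {n d : ℕ}

lemma estPHB_eq_jamesStein (Y : Data n d) :
    estPHB Y = jamesStein (1 : Matrix (Fin d) (Fin d) ℝ) (n : ℝ)⁻¹ (meanVec Y) := by
  ext j
  simp only [estPHB, jamesStein, meanVec, Matrix.transpose_one, Fintype.card_fin,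
    EuclideanSpace.real_norm_sq_eq, Matrix.toLpLin_one, LinearMap.id_apply, PiLp.sub_apply,
    PiLp.smul_apply, smul_eq_mul]
  ring

lemma exists_mul_transpose_eq_one_sub_vecMulVec {ι : Type*} [Fintype ι] [DecidableEq ι]
    {e : EuclideanSpace ℝ ι} (he : ‖e‖ = 1) (i₀ : ι) :
    ∃ W : Matrix ι {k // k ≠ i₀} ℝ, Wᵀ * W = 1 ∧ W * Wᵀ = 1 - Matrix.vecMulVec e e := by
  have h_orthonormal : Orthonormal ℝ (({i₀} : Set ι).domRestrict fun _ => e) :=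
    ⟨fun _ => he, fun i j hij => (hij (Subsingleton.elim i j)).elim⟩
  obtain ⟨b, hb⟩ := h_orthonormal.exists_orthonormalBasis_extension_of_card_eq (by simp)
  have hb₀ : b i₀ = e := hb i₀ rfl
  let B : Matrix ι ι ℝ := Matrix.of fun i k => b k i
  have h_gram : Bᵀ * B = 1 := by
    ext k l
    have h := orthonormal_iff_ite.1 b.orthonormal k l
    rw [PiLp.inner_apply] at h
    simpa [B, Matrix.mul_apply, Matrix.one_apply, mul_comm] using h
  have h_complete : B * Bᵀ = 1 := mul_eq_one_comm.1 h_gram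
  refine ⟨B.submatrix id Subtype.val, ?_, ?_⟩
  · ext k l
    simpa [Matrix.mul_apply, Matrix.one_apply, Subtype.ext_iff] using
      congrFun (congrFun h_gram k) l
  · ext i j
    have h := congrFun (congrFun h_complete i) j
    rw [Matrix.mul_apply, Fintype.sum_eq_add_sum_subtype_ne _ i₀] at h
    rw [Matrix.sub_apply, ← h, Matrix.vecMulVec_apply, ← hb₀]
    simp [B, Matrix.mul_apply]

lemma card_subtype_ne_add_one {ι : Type*} [Fintype ι] [DecidableEq ι] (i₀ : ι) :
    Fintype.card {k // k ≠ i₀} + 1 = Fintype.card ι := by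
  rw [Fintype.card_subtype_compl (· = i₀), Fintype.card_subtype_eq,
    Nat.sub_add_cancel (Fintype.card_pos_iff.2 ⟨i₀⟩)]

lemma exists_mul_transpose_eq_centering (i₀ : Fin d) :
    ∃ W : Matrix (Fin d) {k // k ≠ i₀} ℝ,
      Wᵀ * W = 1 ∧ W * Wᵀ = 1 - (d : ℝ)⁻¹ • Matrix.vecMulVec 1 1 := by
  have hd : (d : ℝ) ≠ 0 := Nat.cast_ne_zero.2 i₀.pos.ne'
  let e : EuclideanSpace ℝ (Fin d) := WithLp.toLp 2 ((√d)⁻¹ • 1)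
  have he : ‖e‖ = 1 := by
    simp [e, EuclideanSpace.norm_eq, hd]
  have he_vecMulVec : Matrix.vecMulVec e e = (d : ℝ)⁻¹ • Matrix.vecMulVec 1 1 := by
    simp only [e, Matrix.smul_vecMulVec, Matrix.vecMulVec_smul, smul_smul, ← mul_inv,
      Real.mul_self_sqrt (Nat.cast_nonneg d)]
  rw [← he_vecMulVec]
  exact exists_mul_transpose_eq_one_sub_vecMulVec he i₀

lemma estHB_eq_jamesStein {κ : Type*} [Fintype κ] [DecidableEq κ] {W : Matrix (Fin d) κ ℝ}
    (hW : Wᵀ * W = 1) (hWW : W * Wᵀ = 1 - (d : ℝ)⁻¹ • Matrix.vecMulVec 1 1)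
    (hκ : Fintype.card κ + 1 = d) (Y : Data n d) :
    estHB Y = jamesStein W (n : ℝ)⁻¹ (meanVec Y) := by
  have h_center : W.toEuclideanLin (Wᵀ.toEuclideanLin (meanVec Y)) =
      WithLp.toLp 2 fun j => popMean Y j - grandMean Y := by
    ext j
    simp [Matrix.toLpLin_apply, hWW, meanVec, grandMean, Matrix.sub_mulVec, Matrix.smul_mulVec,
      Matrix.vecMulVec_mulVec, div_eq_inv_mul, -Matrix.vecMulVec_one,
      -Matrix.one_vecMulVec, one_dotProduct]
  have h_card : (Fintype.card κ : ℝ) - 2 = d - 3 := by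
    rw [← hκ]; push_cast; ring
  ext j
  rw [jamesStein, ← norm_toEuclideanLin hW, h_center, h_card]
  simp only [estHB, meanVec, EuclideanSpace.real_norm_sq_eq, PiLp.sub_apply, PiLp.smul_apply,
    smul_eq_mul]
  ring

end Estimators

section Radicands

variable {ι : Type*} [Fintype ι] [DecidableEq ι]

lemma det_diagonal_add_vecMulVec {a : ι → ℝ} (ha : ∀ j, a j ≠ 0) (x y : ι → ℝ) :
    (Matrix.diagonal a + Matrix.vecMulVec x y).det =
      (∏ j, a j) * (1 + ∑ j, x j * y j / a j) := by
  have h_factor : Matrix.diagonal a + Matrix.vecMulVec x y =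
      Matrix.diagonal a * (1 + Matrix.vecMulVec (fun j => x j / a j) y) := by
    ext i j
    rw [Matrix.mul_add, Matrix.mul_one, Matrix.add_apply, Matrix.add_apply,
      Matrix.diagonal_mul, Matrix.vecMulVec_apply, Matrix.vecMulVec_apply]
    have := ha i
    field_simp
  rw [h_factor, Matrix.det_mul, Matrix.det_diagonal, Matrix.vecMulVec_eq Unit,
    Matrix.det_one_add_replicateCol_mul_replicateRow]
  congr 2
  refine Finset.sum_congr rfl fun j _ => ?_
  ring

lemma nonneg_of_posSemidef_conj_diagonal {P : Matrix ι ι ℝ} (hP : Pᵀ * P = 1) {lam : ι → ℝ}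
    (h : (P * Matrix.diagonal lam * Pᵀ).PosSemidef) (j : ι) : 0 ≤ lam j := by
  have h_conj : Pᵀ * (P * Matrix.diagonal lam * Pᵀ) * P = Matrix.diagonal lam := by
    calc Pᵀ * (P * Matrix.diagonal lam * Pᵀ) * P
        = (Pᵀ * P) * Matrix.diagonal lam * (Pᵀ * P) := by simp only [Matrix.mul_assoc]
      _ = Matrix.diagonal lam := by rw [hP, Matrix.one_mul, Matrix.mul_one]
  exact Matrix.posSemidef_diagonal_iff.1
    (h_conj ▸ posSemidef_transpose_mul_mul_same h P) j

lemma det_one_add_smul_compress_conj_diagonal {κ : Type*} [Fintype κ] [DecidableEq κ]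
    {P : Matrix ι ι ℝ} (hP : Pᵀ * P = 1) {lam : ι → ℝ} {c a : ℝ}
    (hlam : ∀ j, 1 + c * lam j ≠ 0) {W : Matrix ι κ ℝ} {e : ι → ℝ}
    (hWW : W * Wᵀ = 1 - a • Matrix.vecMulVec e e) :
    (1 + c • (Wᵀ * (P * Matrix.diagonal lam * Pᵀ) * W)).det =
      (1 - c * a * ∑ j, lam j * (Pᵀ *ᵥ e) j ^ 2 / (1 + c * lam j)) * ∏ j, (1 + c * lam j) := by
  have h_project : Pᵀ * (W * Wᵀ) * P =
      1 - a • Matrix.vecMulVec (Pᵀ *ᵥ e) (Pᵀ *ᵥ e) := by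
    rw [hWW, Matrix.mul_sub, Matrix.sub_mul, Matrix.mul_one, hP, Matrix.mul_smul,
      Matrix.smul_mul, Matrix.mul_vecMulVec, Matrix.vecMulVec_mul, Matrix.mulVec_transpose]
  have h_rank_one : 1 + c • (Matrix.diagonal lam * (Pᵀ * (W * Wᵀ) * P)) =
      Matrix.diagonal (fun j => 1 + c * lam j) +
        Matrix.vecMulVec (fun j => -(c * a * (lam j * (Pᵀ *ᵥ e) j))) (Pᵀ *ᵥ e) := by
    rw [h_project]
    ext i j
    obtain rfl | hij := eq_or_ne i j
    · simp only [Matrix.add_apply, Matrix.one_apply_eq, Matrix.smul_apply, Matrix.diagonal_mul,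
        Matrix.sub_apply, Matrix.vecMulVec_apply, smul_eq_mul, Matrix.diagonal_apply_eq]
      ring
    · simp only [Matrix.add_apply, Matrix.one_apply_ne hij, Matrix.smul_apply, Matrix.diagonal_mul,
        Matrix.sub_apply, Matrix.vecMulVec_apply, smul_eq_mul, Matrix.diagonal_apply_ne _ hij]
      ring
  calc (1 + c • (Wᵀ * (P * Matrix.diagonal lam * Pᵀ) * W)).det
      = (1 + Wᵀ * P * (c • (Matrix.diagonal lam * (Pᵀ * W)))).det := by
        simp only [Matrix.mul_smul, Matrix.mul_assoc]
    _ = (1 + c • (Matrix.diagonal lam * (Pᵀ * (W * Wᵀ) * P))).det := by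
        rw [Matrix.det_one_add_mul_comm]
        simp only [Matrix.smul_mul, Matrix.mul_assoc]
    _ = _ := by
        rw [h_rank_one, det_diagonal_add_vecMulVec hlam, mul_comm, sub_eq_add_neg, Finset.mul_sum,
          ← Finset.sum_neg_distrib]
        congr 2
        refine Finset.sum_congr rfl fun j _ => ?_
        ring

variable {n d : ℕ} {P : Matrix (Fin d) (Fin d) ℝ} (hP : Pᵀ * P = 1) {lam : Fin d → ℝ}

include hP

lemma xi₂_eq_det (n : ℕ) (lam : Fin d → ℝ) (u : ℝ) :
    xi₂ n lam u = (1 + (n * (1 - u)) • (P * Matrix.diagonal lam * Pᵀ)).det :=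
  (det_one_add_smul_conj_diagonal hP lam _).symm

lemma xi₁_eq_det {κ : Type*} [Fintype κ] [DecidableEq κ] {W : Matrix (Fin d) κ ℝ}
    (hWW : W * Wᵀ = 1 - (d : ℝ)⁻¹ • Matrix.vecMulVec 1 1) (hlam : ∀ j, 0 ≤ lam j)
    {u : ℝ} (hu : u ≤ 1) :
    xi₁ n lam (Pᵀ *ᵥ 1) u =
      (1 + (n * (1 - u)) • (Wᵀ * (P * Matrix.diagonal lam * Pᵀ) * W)).det := by
  have hc : 0 ≤ n * (1 - u) := mul_nonneg n.cast_nonneg (sub_nonneg.2 hu)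
  rw [det_one_add_smul_compress_conj_diagonal hP
    (fun j => (add_pos_of_pos_of_nonneg one_pos (mul_nonneg hc (hlam j))).ne') hWW,
    ← div_eq_mul_inv]
  rfl

end Radicands

section IntegratedRisk

variable {n d : ℕ}

lemma finiteIntegratedRisk_estPHB (hn : n ≠ 0) (hd : 3 ≤ d)
    {S : Matrix (Fin d) (Fin d) ℝ} (hS : S.PosSemidef) :
    FiniteIntegratedRisk (n := n) estPHB (multivariateGaussian 0 S) := by
  rw [funext estPHB_eq_jamesStein]
  exact finiteIntegratedRisk_jamesStein hn (by simp) (by rwa [Fintype.card_fin]) hS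

lemma finiteIntegratedRisk_estHB (hn : n ≠ 0) (hd : 4 ≤ d)
    {S : Matrix (Fin d) (Fin d) ℝ} (hS : S.PosSemidef) :
    FiniteIntegratedRisk (n := n) estHB (multivariateGaussian 0 S) := by
  let i₀ : Fin d := ⟨0, by omega⟩
  obtain ⟨W, hW, hWW⟩ := exists_mul_transpose_eq_centering i₀
  have h_card := (card_subtype_ne_add_one i₀).trans (Fintype.card_fin d)
  rw [funext (estHB_eq_jamesStein hW hWW h_card)]
  exact finiteIntegratedRisk_jamesStein hn hW (by omega) hS

variable {P : Matrix (Fin d) (Fin d) ℝ} {lam : Fin d → ℝ} (hP : Pᵀ * P = 1)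
  (hS : (P * Matrix.diagonal lam * Pᵀ).PosSemidef)

include hP hS

lemma xi₂_pos {u : ℝ} (hu : u ≤ 1) : 0 < xi₂ n lam u := by
  rw [xi₂_eq_det hP]
  exact det_one_add_smul_pos hS (mul_nonneg n.cast_nonneg (sub_nonneg.2 hu))

lemma xi₁_pos (hd : d ≠ 0) {u : ℝ} (hu : u ≤ 1) : 0 < xi₁ n lam (Pᵀ *ᵥ 1) u := by
  obtain ⟨W, -, hWW⟩ := exists_mul_transpose_eq_centering (⟨0, by omega⟩ : Fin d)
  rw [xi₁_eq_det hP hWW (nonneg_of_posSemidef_conj_diagonal hP hS) hu]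
  exact det_one_add_smul_pos (posSemidef_transpose_mul_mul_same hS W)
    (mul_nonneg n.cast_nonneg (sub_nonneg.2 hu))

lemma intervalIntegrable_rpow_div_sqrt_xi₂ {r : ℝ} (hr : -1 < r) :
    IntervalIntegrable (fun u => u ^ r / √(xi₂ n lam u)) volume 0 1 := by
  simp only [xi₂_eq_det hP]
  exact intervalIntegrable_rpow_div_sqrt_det hS n.cast_nonneg hr

lemma intervalIntegrable_rpow_div_sqrt_xi₁ (hd : d ≠ 0) {r : ℝ} (hr : -1 < r) :
    IntervalIntegrable (fun u => u ^ r / √(xi₁ n lam (Pᵀ *ᵥ 1) u)) volume 0 1 := by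
  obtain ⟨W, -, hWW⟩ := exists_mul_transpose_eq_centering (⟨0, by omega⟩ : Fin d)
  refine (intervalIntegrable_rpow_div_sqrt_det (posSemidef_transpose_mul_mul_same hS W)
    n.cast_nonneg hr).congr fun u hu => ?_
  have hu' : u ≤ 1 := by simpa using hu.2
  simp only [xi₁_eq_det hP hWW (nonneg_of_posSemidef_conj_diagonal hP hS) hu']

lemma integratedRisk_estPHB (hn : n ≠ 0) (hd : 3 ≤ d) :
    integratedRisk (n := n) estPHB (multivariateGaussian 0 (P * Matrix.diagonal lam * Pᵀ)) =
      d / n - ((d : ℝ) - 2) ^ 2 / (2 * n) *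
        ∫ u in (0 : ℝ)..1, u ^ (((d : ℝ) - 2) / 2 - 1) / √(xi₂ n lam u) := by
  rw [funext estPHB_eq_jamesStein,
    integratedRisk_jamesStein hn (by simp) (by rwa [Fintype.card_fin]) hS]
  simp only [xi₂_eq_det hP, Matrix.transpose_one, Matrix.one_mul, Matrix.mul_one, Fintype.card_fin]

lemma integratedRisk_estHB (hn : n ≠ 0) (hd : 4 ≤ d) :
    integratedRisk (n := n) estHB (multivariateGaussian 0 (P * Matrix.diagonal lam * Pᵀ)) =
      d / n - ((d : ℝ) - 3) ^ 2 / (2 * n) *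
        ∫ u in (0 : ℝ)..1, u ^ (((d : ℝ) - 3) / 2 - 1) / √(xi₁ n lam (Pᵀ *ᵥ 1) u) := by
  let i₀ : Fin d := ⟨0, by omega⟩
  obtain ⟨W, hW, hWW⟩ := exists_mul_transpose_eq_centering i₀
  have h_card := (card_subtype_ne_add_one i₀).trans (Fintype.card_fin d)
  have h_card' : (Fintype.card {k // k ≠ i₀} : ℝ) - 2 = d - 3 := by
    have h_cast : (Fintype.card {k // k ≠ i₀} : ℝ) + 1 = d := mod_cast h_card
    linarith
  rw [funext (estHB_eq_jamesStein hW hWW h_card),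
    integratedRisk_jamesStein hn hW (by omega) hS, h_card']
  congr 2
  refine intervalIntegral.integral_congr fun u hu => ?_
  have hu' : u ≤ 1 := by simpa using hu.2
  simp only [xi₁_eq_det hP hWW (nonneg_of_posSemidef_conj_diagonal hP hS) hu']

end IntegratedRisk

end NormalMeans

theorem proposition2_general (n d : ℕ) (hn : 1 ≤ n) (hd : 4 ≤ d)
    (S : Matrix (Fin d) (Fin d) ℝ) (hS : S.PosSemidef)
    (P : Matrix (Fin d) (Fin d) ℝ) (hP : P ∈ Matrix.orthogonalGroup (Fin d) ℝ)
    (lam : Fin d → ℝ) (hPS : P * Matrix.diagonal lam * Pᵀ = S)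
    (Z : Fin d → ℝ) (hZ : Z = Pᵀ *ᵥ (fun _ => 1)) :
    (∀ u ∈ Set.Icc (0 : ℝ) 1,
      0 < NormalMeans.xi₁ n lam Z u ∧ 0 < NormalMeans.xi₂ n lam u) ∧
    NormalMeans.FiniteIntegratedRisk (n := n) NormalMeans.estHB (multivariateGaussian 0 S) ∧
    IntervalIntegrable
      (fun u : ℝ => u ^ (((d : ℝ) - 3) / 2 - 1) / √(NormalMeans.xi₁ n lam Z u)) volume 0 1 ∧
    NormalMeans.integratedRisk (n := n) NormalMeans.estHB (multivariateGaussian 0 S) =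
      (d : ℝ) / n - ((d : ℝ) - 3) ^ 2 / (2 * n) *
        ∫ u in (0 : ℝ)..1, u ^ (((d : ℝ) - 3) / 2 - 1) / √(NormalMeans.xi₁ n lam Z u) ∧
    NormalMeans.FiniteIntegratedRisk (n := n) NormalMeans.estPHB (multivariateGaussian 0 S) ∧
    IntervalIntegrable
      (fun u : ℝ => u ^ (((d : ℝ) - 2) / 2 - 1) / √(NormalMeans.xi₂ n lam u)) volume 0 1 ∧
    NormalMeans.integratedRisk (n := n) NormalMeans.estPHB (multivariateGaussian 0 S) =
      (d : ℝ) / n - ((d : ℝ) - 2) ^ 2 / (2 * n) *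
        ∫ u in (0 : ℝ)..1, u ^ (((d : ℝ) - 2) / 2 - 1) / √(NormalMeans.xi₂ n lam u) := by
  subst hPS hZ
  have hn' : n ≠ 0 := by omega
  have hd' : d ≠ 0 := by omega
  have hd_real : (4 : ℝ) ≤ d := mod_cast hd
  have hP' : Pᵀ * P = 1 := (Matrix.mem_orthogonalGroup_iff' _ _).1 hP
  exact ⟨fun u hu => ⟨NormalMeans.xi₁_pos hP' hS hd' hu.2, NormalMeans.xi₂_pos hP' hS hu.2⟩,
    NormalMeans.finiteIntegratedRisk_estHB hn' hd hS,
    NormalMeans.intervalIntegrable_rpow_div_sqrt_xi₁ hP' hS hd' (by linarith),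
    NormalMeans.integratedRisk_estHB hP' hS hn' hd,
    NormalMeans.finiteIntegratedRisk_estPHB hn' (by omega) hS,
    NormalMeans.intervalIntegrable_rpow_div_sqrt_xi₂ hP' hS (by linarith),
    NormalMeans.integratedRisk_estPHB hP' hS hn' (by omega)⟩

theorem proposition2 (n d : ℕ) (hn : 1 ≤ n) (hd : 4 ≤ d)
    (S : Matrix (Fin d) (Fin d) ℝ) (hS : S.PosDef)
    (P : Matrix (Fin d) (Fin d) ℝ) (hP : P ∈ Matrix.orthogonalGroup (Fin d) ℝ)
    (lam : Fin d → ℝ) (hPS : P * Matrix.diagonal lam * Pᵀ = S)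
    (Z : Fin d → ℝ) (hZ : Z = Pᵀ *ᵥ (fun _ => 1)) :
    -- the integrands are well defined: the radicands are positive on `[0, 1]`
    (∀ u ∈ Set.Icc (0 : ℝ) 1,
      0 < NormalMeans.xi₁ n lam Z u ∧ 0 < NormalMeans.xi₂ n lam u) ∧
    -- hierarchical Bayes
    NormalMeans.FiniteIntegratedRisk (n := n) NormalMeans.estHB (multivariateGaussian 0 S) ∧
    IntervalIntegrable
      (fun u : ℝ => u ^ (((d : ℝ) - 3) / 2 - 1) / √(NormalMeans.xi₁ n lam Z u)) volume 0 1 ∧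
    NormalMeans.integratedRisk (n := n) NormalMeans.estHB (multivariateGaussian 0 S) =
      (d : ℝ) / n - ((d : ℝ) - 3) ^ 2 / (2 * n) *
        ∫ u in (0 : ℝ)..1, u ^ (((d : ℝ) - 3) / 2 - 1) / √(NormalMeans.xi₁ n lam Z u) ∧
    -- partial-hierarchical Bayes
    NormalMeans.FiniteIntegratedRisk (n := n) NormalMeans.estPHB (multivariateGaussian 0 S) ∧
    IntervalIntegrable
      (fun u : ℝ => u ^ (((d : ℝ) - 2) / 2 - 1) / √(NormalMeans.xi₂ n lam u)) volume 0 1 ∧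
    NormalMeans.integratedRisk (n := n) NormalMeans.estPHB (multivariateGaussian 0 S) =
      (d : ℝ) / n - ((d : ℝ) - 2) ^ 2 / (2 * n) *
        ∫ u in (0 : ℝ)..1, u ^ (((d : ℝ) - 2) / 2 - 1) / √(NormalMeans.xi₂ n lam u) := by
  exact proposition2_general n d hn hd S hS.posSemidef P hP lam hPS Z hZ
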